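/- Consider a finite discounted Markov decision process with finite state space $\mathcal{S}$, nonempty finite action space $\mathcal{A}$, transition probabilities $P(s'|s,a)$, reward $r:\mathcal{S}\times\mathcal{A}\to[0,1]$ and discount factor $\gamma\in[0,1)$. For a policy $\pi=(\pi(\cdot|s))_{s\in\mathcal{S}}$, each $\pi(\cdot|s)$ being a probability distribution on $\mathcal{A}$, let $$V^\pi(s)=\mathbb{E}\Big[\sum_{t=0}^\infty\gamma^t r(s_t,a_t)\,\Big|\,s_0=s,\ a_t\sim\pi(\cdot|s_t),\ s_{t+1}\sim P(\cdot|s_t,a_t)\Big],\qquad V^\pi(\mu)=\sum_{s}\mu(s)V^\pi(s),$$ and let $V^*(s)=\sup_\pi V^\pi(s)$ be the optimal state value. Let $\mu$ be a probability distribution on $\mathcal{S}$ with $\mu(s)>0$ for every $s$. For $\theta\in\mathbb{R}^{\mathcal{S}\times\mathcal{A}}$ let $\pi_\theta(a|s)=\exp(\theta_{s,a})/\sum_{a'}\exp(\theta_{s,a'})$ be the softmax policy. Softmax policy gradient with step sizes $(\eta_k)_{k\ge0}$, started from an arbitrary $\theta^0$, is the iteration $$\theta^{k+1}=\theta^k+\eta_k\,\nabla_\theta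 V^{\pi_\theta}(\mu)\big|_{\theta=\theta^k}.$$ Write $V^k=V^{\pi_{\theta^k}}$. **Theorem.** If $\inf_k\eta_k\ge\alpha$ for some $\alpha>0$, then $\lim_{k\to\infty}V^k(s)=V^*(s)$ for every $s\in\mathcal{S}$. -/

import Mathlib

open MeasureTheory ProbabilityTheory Filter Topology

namespace FiniteMDP

noncomputable section

/-- The probability measure on a finite set given by a point of the probability simplex. -/
def simplexMeasure {X : Type*} [Fintype X] [MeasurableSpace X] (p : stdSimplex ℝ X) : Measure X :=
  ∑ x, ENNReal.ofReal (p x) • Measure.dirac x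

instance {X : Type*} [Fintype X] [MeasurableSpace X] (p : stdSimplex ℝ X) :
    IsProbabilityMeasure (simplexMeasure p) := by
  constructor
  simp only [simplexMeasure, Measure.finsetSum_apply, Measure.smul_apply, measure_univ,
    smul_eq_mul, mul_one]
  rw [← ENNReal.ofReal_sum_of_nonneg fun x _ => stdSimplex.zero_le p x, stdSimplex.sum_eq_one,
    ENNReal.ofReal_one]

/-- A discounted Markov decision process with finite state space `S`, finite action space `A`,
transition probabilities `P s a s'` from `s` to `s'` under the action `a`, rewards in `[0, 1]`
and discount factor `γ ∈ [0, 1)`. -/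
structure MDP (S A : Type*) [Fintype S] where
  P : S → A → stdSimplex ℝ S
  r : S → A → ℝ
  r_mem : ∀ s a, r s a ∈ Set.Icc (0 : ℝ) 1
  γ : ℝ
  γ_mem : γ ∈ Set.Ico (0 : ℝ) 1

/-- The set `Π` of all (stationary, randomized) policies: `π s a` is the probability of taking the
action `a` in the state `s`. -/
abbrev Policy (S A : Type*) [Fintype A] : Type _ := S → stdSimplex ℝ A

section Value

variable {S A : Type*} [Fintype S] [Fintype A] [MeasurableSpace S] [MeasurableSpace A]

/-- The law of a state-action pair whose state has law `p` and whose action is then drawn from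
the policy `π`. -/
def pairMeasure (p : stdSimplex ℝ S) (π : Policy S A) : Measure (S × A) :=
  ∑ s, ENNReal.ofReal (p s) • (Measure.dirac s).prod (simplexMeasure (π s))

instance (p : stdSimplex ℝ S) (π : Policy S A) : IsProbabilityMeasure (pairMeasure p π) := by
  constructor
  simp only [pairMeasure, Measure.finsetSum_apply, Measure.smul_apply, measure_univ,
    smul_eq_mul, mul_one]
  rw [← ENNReal.ofReal_sum_of_nonneg fun x _ => stdSimplex.zero_le p x, stdSimplex.sum_eq_one,
    ENNReal.ofReal_one]

variable [MeasurableSingletonClass S] [MeasurableSingletonClass A]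

/-- The transition kernel of the chain of state-action pairs: from `(s, a)` the next state is drawn
from `P s a`, and the next action from the policy `π` at this next state. -/
def stepKernel (M : MDP S A) (π : Policy S A) : Kernel (S × A) (S × A) :=
  Kernel.ofFunOfCountable fun x => pairMeasure (M.P x.1 x.2) π

instance (M : MDP S A) (π : Policy S A) : IsMarkovKernel (stepKernel M π) :=
  ⟨fun x => inferInstanceAs (IsProbabilityMeasure (pairMeasure (M.P x.1 x.2) π))⟩

/-- The transition kernel at time `t`, given the whole history up to time `t`: it only depends on
the pair `(s_t, a_t)`. -/
def historyKernel (M : MDP S A) (π : Policy S A) (t : ℕ) :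
    Kernel (Finset.Iic t → S × A) (S × A) :=
  (stepKernel M π).comap (fun h => h ⟨t, Finset.mem_Iic.2 le_rfl⟩) (measurable_pi_apply _)

instance (M : MDP S A) (π : Policy S A) (t : ℕ) : IsMarkovKernel (historyKernel M π t) :=
  inferInstanceAs (IsMarkovKernel ((stepKernel M π).comap _ _))

/-- The law of the random trajectory `(s_0, a_0), (s_1, a_1), …` with `s_0 = s`,
`a_t ∼ π(·|s_t)` and `s_{t+1} ∼ P(·|s_t, a_t)`. -/
def trajectoryLaw (M : MDP S A) (π : Policy S A) (s : S) : Measure (ℕ → S × A) :=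
  Kernel.trajMeasure (X := fun _ => S × A)
    ((Measure.dirac s).prod (simplexMeasure (π s))) (historyKernel M π)

/-- The state value `V^π(s) = 𝔼[∑_{t ≥ 0} γ^t r(s_t, a_t) | s_0 = s, π]`. -/
def value (M : MDP S A) (π : Policy S A) (s : S) : ℝ :=
  ∫ ω, ∑' t : ℕ, M.γ ^ t * M.r (ω t).1 (ω t).2 ∂(trajectoryLaw M π s)

/-- The expected state value `V^π(μ) = 𝔼_{s ∼ μ}[V^π(s)]`. -/
def valueAt (M : MDP S A) (π : Policy S A) (μ : stdSimplex ℝ S) : ℝ :=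
  ∑ s, μ s * value M π s

/-- The optimal state value `V^*(s) = max_{π ∈ Π} V^π(s)`. -/
def optValue (M : MDP S A) (s : S) : ℝ :=
  ⨆ π : Policy S A, value M π s

end Value

/-- The softmax policy `π_θ(a|s) = exp(θ_{s,a}) / ∑_{a'} exp(θ_{s,a'})`. -/
def softmaxPolicy {S A : Type*} [Fintype S] [Fintype A] [Nonempty A]
    (θ : EuclideanSpace ℝ (S × A)) : Policy S A := fun s =>
  ⟨fun a => Real.exp (θ (s, a)) / ∑ a', Real.exp (θ (s, a')),
    fun _ => by positivity,
    by
      rw [← Finset.sum_div]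
      exact div_self (by positivity)⟩

/-- The parameters produced by softmax policy gradient with initial parameter `θ₀` and step size
`η k` in the `k`-th iteration: `θ^{k+1} = θ^k + η_k ∇_θ V^{π_θ}(μ)` at `θ = θ^k`. -/
def softmaxPG {S A : Type*} [Fintype S] [Fintype A] [Nonempty A]
    [MeasurableSpace S] [MeasurableSingletonClass S]
    [MeasurableSpace A] [MeasurableSingletonClass A]
    (M : MDP S A) (μ : stdSimplex ℝ S) (η : ℕ → ℝ) (θ₀ : EuclideanSpace ℝ (S × A)) :
    ℕ → EuclideanSpace ℝ (S × A)
  | 0 => θ₀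
  | k + 1 => softmaxPG M μ η θ₀ k +
      η k • gradient (fun θ => valueAt M (softmaxPolicy θ) μ) (softmaxPG M μ η θ₀ k)

end

end FiniteMDP

/-! In each state the gradient step adds `c * p a * adv a` to the logit of `a`, where `p` is the
current softmax, `adv` is the advantage, and `c ≥ α μ(s) > 0` by the policy gradient theorem
(`exists_softmaxPG_succ_eq`). Such a step multiplies `p a` by `exp (c * p a * adv a)` and
renormalizes. Since `∑ p a * adv a = 0`, the mean old advantage under the new policy is nonnegative,
however large `c` is (`exists_max_improvement`). By the comparison principle the values therefore
increase. Being bounded, they converge to some `V`, and the mean advantages of successive policies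
tend to `0`.

It remains to show that the limiting advantages `L` are nonpositive, for then `V` dominates its
one-step look-aheads and hence every policy value. This is `softmax_ascent_limit_adv_nonpos`.
Suppose `L a₀ > 0`. Vanishing improvement forces `p a * adv a → 0`, so actions with `L a ≠ 0`,
including `a₀`, lose all mass. The logit of `a₀` eventually increases, so actions with `L a < 0`,
whose logits are bounded above, have mass at most a constant times that of `a₀`. An action with `L a
= 0` is eventually below `a₀` or eventually above it, the latter forming a set `B`. Steps preserve
the sum of all logits, so `B` gains only what the other actions lose, and this loss is controlled by
the gain of `a₀`. Hence the logits in `B` are bounded above and `B` loses its mass too, which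
contradicts total mass one. -/

namespace FiniteMDP

/-! ### Softmax ascent in a single state -/

section Softmax

variable {A : Type*} [Fintype A]

/-- The softmax weights of a vector of logits. -/
noncomputable def softmax (x : A → ℝ) (a : A) : ℝ := Real.exp (x a) / ∑ b, Real.exp (x b)

theorem softmax_pos (x : A → ℝ) (a : A) : 0 < softmax x a := by
  have : Nonempty A := ⟨a⟩
  unfold softmax
  positivity

theorem sum_softmax [Nonempty A] (x : A → ℝ) : ∑ a, softmax x a = 1 := by
  unfold softmax
  rw [← Finset.sum_div]
  exact div_self (by positivity)

theorem softmax_eq_mul_exp_sub (x : A → ℝ) (a b : A) :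
    softmax x a = softmax x b * Real.exp (x a - x b) := by
  unfold softmax
  rw [Real.exp_sub]
  field_simp

theorem softmax_le_mul_of_sub_le {x : A → ℝ} {a b : A} {C : ℝ} (h : x a - x b ≤ C) :
    softmax x a ≤ Real.exp C * softmax x b := by
  rw [softmax_eq_mul_exp_sub x a b, mul_comm]
  exact mul_le_mul_of_nonneg_right (Real.exp_le_exp.2 h) (softmax_pos x b).le

theorem softmax_le_softmax {x : A → ℝ} {a b : A} (h : x a ≤ x b) : softmax x a ≤ softmax x b := by
  simpa using softmax_le_mul_of_sub_le (C := 0) (sub_nonpos.2 h)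

theorem softmax_add [Nonempty A] (x d : A → ℝ) (a : A) :
    softmax (fun b => x b + d b) a =
      softmax x a * Real.exp (d a) / ∑ b, softmax x b * Real.exp (d b) := by
  have h : (∑ b, Real.exp (x b)) ≠ 0 := by positivity
  have h2 : (∑ b, Real.exp (x b) * Real.exp (d b)) ≠ 0 := by positivity
  have e : ∑ b, softmax x b * Real.exp (d b) =
      (∑ b, Real.exp (x b) * Real.exp (d b)) / ∑ b, Real.exp (x b) := by
    rw [Finset.sum_div]
    exact Finset.sum_congr rfl fun b _ => by unfold softmax; ring
  rw [e]
  simp only [softmax, Real.exp_add]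
  field_simp

/-- The numbers `t` and `exp (η t) - 1` have the same sign. This is why no smallness of the step
size is needed. -/
theorem mul_exp_sub_one_nonneg {η p v : ℝ} (hη : 0 ≤ η) :
    0 ≤ p * v * (Real.exp (η * (p * v)) - 1) := by
  rcases le_total 0 (p * v) with h | h
  · exact mul_nonneg h (sub_nonneg.2 (Real.one_le_exp (mul_nonneg hη h)))
  · exact mul_nonneg_of_nonpos_of_nonpos h
      (sub_nonpos.2 (Real.exp_le_one_iff.2 (mul_nonpos_of_nonneg_of_nonpos hη h)))

/-- One step of softmax gradient ascent, with any step size, improves the mean advantage. -/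
theorem exists_max_improvement [Nonempty A] (x adv : A → ℝ) {η c : ℝ} (hc : 0 ≤ c) (hη : c ≤ η)
    (h0 : ∑ a, softmax x a * adv a = 0) :
    ∃ b, (∀ a, softmax x a * adv a ≤ softmax x b * adv b) ∧ 0 ≤ softmax x b * adv b ∧
      softmax x b * adv b * (1 - Real.exp (-(c * (softmax x b * adv b)))) ≤
        ∑ a, softmax (fun a => x a + η * (softmax x a * adv a)) a * adv a := by
  obtain ⟨b, -, hb⟩ := Finset.exists_max_image Finset.univ (fun a => softmax x a * adv a)
    Finset.univ_nonempty
  have hb : ∀ a, softmax x a * adv a ≤ softmax x b * adv b := fun a => hb a (Finset.mem_univ a)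
  have hM : 0 ≤ softmax x b * adv b := by
    by_contra! h
    have := Finset.sum_lt_sum_of_nonempty (Finset.univ_nonempty (α := A))
      (f := fun a => softmax x a * adv a) (g := fun _ => 0) fun a _ => (hb a).trans_lt h
    simp [h0] at this
  refine ⟨b, hb, hM, ?_⟩
  set M := softmax x b * adv b with hMdef
  have hη0 : 0 ≤ η := hc.trans hη
  set Z := ∑ a, softmax x a * Real.exp (η * (softmax x a * adv a)) with hZ
  have hZpos : 0 < Z := Finset.sum_pos
    (fun a _ => mul_pos (softmax_pos x a) (Real.exp_pos _)) Finset.univ_nonempty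
  have hZle : Z ≤ Real.exp (η * M) := by
    calc Z ≤ ∑ a, softmax x a * Real.exp (η * M) := by
          refine Finset.sum_le_sum fun a _ => mul_le_mul_of_nonneg_left ?_ (softmax_pos x a).le
          exact Real.exp_le_exp.2 (mul_le_mul_of_nonneg_left (hb a) hη0)
      _ = Real.exp (η * M) := by rw [← Finset.sum_mul, sum_softmax, one_mul]
  -- Subtracting `1` from the exponential is free because the mean advantage is zero; it makes every
  -- summand nonnegative, so the single term of `b` is a lower bound.
  have hsum : ∑ a, softmax (fun a => x a + η * (softmax x a * adv a)) a * adv a =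
      (∑ a, softmax x a * adv a * (Real.exp (η * (softmax x a * adv a)) - 1)) / Z := by
    have : ∑ a, softmax x a * adv a * (Real.exp (η * (softmax x a * adv a)) - 1) =
        ∑ a, softmax x a * adv a * Real.exp (η * (softmax x a * adv a)) := by
      simp only [mul_sub, mul_one, Finset.sum_sub_distrib, h0, sub_zero]
    rw [this, Finset.sum_div]
    refine Finset.sum_congr rfl fun a _ => ?_
    rw [softmax_add]
    ring
  rw [hsum, le_div_iff₀ hZpos]
  have h1 : M * (Real.exp (η * M) - 1) ≤
      ∑ a, softmax x a * adv a * (Real.exp (η * (softmax x a * adv a)) - 1) :=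
    Finset.single_le_sum (f := fun a => softmax x a * adv a *
      (Real.exp (η * (softmax x a * adv a)) - 1))
      (fun a _ => mul_exp_sub_one_nonneg hη0) (Finset.mem_univ b)
  refine le_trans ?_ h1
  have h2 : Real.exp (-(η * M)) ≤ Real.exp (-(c * M)) :=
    Real.exp_le_exp.2 (neg_le_neg (mul_le_mul_of_nonneg_right hη hM))
  have h3 : Real.exp (-(c * M)) ≤ 1 := Real.exp_le_one_iff.2 (by nlinarith)
  have h4 : Real.exp (-(η * M)) * Real.exp (η * M) = 1 := by rw [← Real.exp_add]; simp
  rw [mul_assoc]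
  refine mul_le_mul_of_nonneg_left ?_ hM
  calc (1 - Real.exp (-(c * M))) * Z ≤ (1 - Real.exp (-(c * M))) * Real.exp (η * M) :=
        mul_le_mul_of_nonneg_left hZle (by linarith)
    _ ≤ (1 - Real.exp (-(η * M))) * Real.exp (η * M) :=
        mul_le_mul_of_nonneg_right (by linarith) (Real.exp_pos _).le
    _ = Real.exp (η * M) - 1 := by rw [sub_mul, h4, one_mul]

theorem sum_softmax_step_mul_nonneg [Nonempty A] (x adv : A → ℝ) {η : ℝ} (hη : 0 ≤ η)
    (h0 : ∑ a, softmax x a * adv a = 0) :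
    0 ≤ ∑ a, softmax (fun a => x a + η * (softmax x a * adv a)) a * adv a := by
  obtain ⟨b, -, -, h⟩ := exists_max_improvement x adv le_rfl hη h0
  simpa using h

theorem eventually_le_of_eventually_succ_le {f : ℕ → ℝ} (h : ∀ᶠ k in atTop, f (k + 1) ≤ f k) :
    ∃ C, ∀ᶠ k in atTop, f k ≤ C := by
  obtain ⟨K, hK⟩ := eventually_atTop.1 h
  refine ⟨f K, eventually_atTop.2 ⟨K, fun k hk => ?_⟩⟩
  induction k, hk using Nat.le_induction with
  | base => exact le_rfl
  | succ n hn ih => exact (hK n hn).trans ih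

theorem tendsto_atTop_or_bounded_of_eventually_le_succ {f : ℕ → ℝ}
    (h : ∀ᶠ k in atTop, f k ≤ f (k + 1)) :
    Tendsto f atTop atTop ∨ ∃ C, ∀ᶠ k in atTop, f k ≤ C := by
  obtain ⟨K, hK⟩ := eventually_atTop.1 h
  have hm : Monotone fun k => f (k + K) := monotone_nat_of_le_succ fun n => by
    simpa [add_right_comm] using hK (n + K) (by omega)
  rcases tendsto_atTop_of_monotone hm with h | ⟨l, hl⟩
  · exact Or.inl ((tendsto_add_atTop_iff_nat K).1 h)
  · exact Or.inr ⟨l + 1, ((tendsto_add_atTop_iff_nat K).1 hl).eventually_le_const (by linarith)⟩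

/-- Along softmax gradient ascent whose improvements vanish, the policy-weighted advantages
vanish. -/
theorem tendsto_softmax_mul_adv [Nonempty A] {x adv : ℕ → A → ℝ} {η : ℕ → ℝ} {c : ℝ}
    (hc : 0 < c) (hη : ∀ k, c ≤ η k)
    (h0 : ∀ k, ∑ a, softmax (x k) a * adv k a = 0)
    (hstep : ∀ k, x (k + 1) = fun a => x k a + η k * (softmax (x k) a * adv k a))
    (himp : Tendsto (fun k => ∑ a, softmax (x (k + 1)) a * adv k a) atTop (𝓝 0)) (a : A) :
    Tendsto (fun k => softmax (x k) a * adv k a) atTop (𝓝 0) := by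
  choose b hmax hnn hb using fun k => exists_max_improvement (x k) (adv k) hc.le (hη k) (h0 k)
  have key : ∀ ε > 0, ∀ᶠ k in atTop, ∀ a, softmax (x k) a * adv k a < ε := by
    intro ε hε
    have hlt : Real.exp (-(c * ε)) < 1 := Real.exp_lt_one_iff.2 (neg_lt_zero.2 (mul_pos hc hε))
    have hpos : 0 < ε * (1 - Real.exp (-(c * ε))) := mul_pos hε (by linarith)
    filter_upwards [himp.eventually_lt_const hpos] with k hk a
    refine (hmax k a).trans_lt ?_
    by_contra! hle
    refine absurd hk (not_lt.2 ?_)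
    rw [hstep]
    refine le_trans ?_ (hb k)
    refine mul_le_mul hle ?_ (by linarith) (hnn k)
    have : Real.exp (-(c * (softmax (x k) (b k) * adv k (b k)))) ≤ Real.exp (-(c * ε)) :=
      Real.exp_le_exp.2 (neg_le_neg (mul_le_mul_of_nonneg_left hle hc.le))
    linarith
  rw [tendsto_order]
  refine ⟨fun l hl => ?_, fun u hu => (key u hu).mono fun k hk => hk a⟩
  have hcard : (0 : ℝ) < Fintype.card A := by exact_mod_cast Fintype.card_pos
  classical
  -- The terms sum to zero, so upper bounds on the other `card A - 1` terms bound the term of `a`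
  -- from below.
  filter_upwards [key (-l / Fintype.card A) (div_pos (by linarith) hcard)] with k hk
  have h1 := h0 k
  rw [← Finset.add_sum_erase _ _ (Finset.mem_univ a)] at h1
  have h2 : ∑ i ∈ Finset.univ.erase a, softmax (x k) i * adv k i ≤
      (Finset.univ.erase a).card • (-l / Fintype.card A) :=
    Finset.sum_le_card_nsmul _ _ _ fun i _ => (hk i).le
  rw [Finset.card_erase_of_mem (Finset.mem_univ a), Finset.card_univ, nsmul_eq_mul,
    Nat.cast_sub Fintype.card_pos, Nat.cast_one] at h2
  have h3 : ((Fintype.card A : ℝ) - 1) * (-l / Fintype.card A) = -l - (-l / Fintype.card A) := by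
    rw [sub_mul, one_mul, mul_div_cancel₀ _ hcard.ne']
  have h4 : 0 < -l / Fintype.card A := div_pos (by linarith) hcard
  linarith

/-- If the improvements of softmax gradient ascent vanish and the advantages converge, then the
limiting advantages are nonpositive. -/
theorem softmax_ascent_limit_adv_nonpos [Nonempty A] {x adv : ℕ → A → ℝ} {η : ℕ → ℝ} {c : ℝ}
    {L : A → ℝ} (hc : 0 < c) (hη : ∀ k, c ≤ η k)
    (hL : ∀ a, Tendsto (fun k => adv k a) atTop (𝓝 (L a)))
    (h0 : ∀ k, ∑ a, softmax (x k) a * adv k a = 0)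
    (hstep : ∀ k, x (k + 1) = fun a => x k a + η k * (softmax (x k) a * adv k a))
    (himp : Tendsto (fun k => ∑ a, softmax (x (k + 1)) a * adv k a) atTop (𝓝 0)) (a₀ : A) :
    L a₀ ≤ 0 := by
  classical
  by_contra! ha₀
  have hη0 : ∀ k, 0 < η k := fun k => hc.trans_le (hη k)
  have hstep' : ∀ k a, x (k + 1) a = x k a + η k * (softmax (x k) a * adv k a) :=
    fun k a => congrFun (hstep k) a
  set D : ℕ → A → ℝ := fun k a => η k * (softmax (x k) a * adv k a) with hD
  have hDsum : ∀ k, ∑ a, D k a = 0 := fun k => by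
    simp only [hD, ← Finset.mul_sum, h0, mul_zero]
  have hp : ∀ k a, 0 < softmax (x k) a := fun k a => softmax_pos _ _
  -- The threshold `ε` eventually separates the advantage of `a₀` from the advantages that tend to
  -- zero.
  obtain ⟨ε, hε, hεL⟩ : ∃ ε > 0, ε < L a₀ := ⟨L a₀ / 2, by linarith, by linarith⟩
  have hadv₀ : ∀ᶠ k in atTop, ε ≤ adv k a₀ :=
    ((hL a₀).eventually_const_lt hεL).mono fun _ h => h.le
  -- actions with nonzero limiting advantage lose all their mass
  have hp0 : ∀ a, L a ≠ 0 → Tendsto (fun k => softmax (x k) a) atTop (𝓝 0) := by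
    intro a ha
    have h1 := (tendsto_softmax_mul_adv hc hη h0 hstep himp a).div (hL a) ha
    rw [zero_div] at h1
    refine h1.congr' ?_
    filter_upwards [(hL a).eventually_ne ha] with k hk
    simp only [Pi.div_apply]
    field_simp
  have hpa₀ := hp0 a₀ ha₀.ne'
  have hdom : ∀ a C, (∀ᶠ k in atTop, softmax (x k) a ≤ C * softmax (x k) a₀) →
      Tendsto (fun k => softmax (x k) a) atTop (𝓝 0) := by
    intro a C h
    refine squeeze_zero' (Eventually.of_forall fun k => (hp k a).le) h ?_
    simpa using hpa₀.const_mul C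
  have hDpos : ∀ a, 0 < L a → ∀ᶠ k in atTop, 0 ≤ D k a := fun a ha =>
    ((hL a).eventually_const_lt ha).mono fun k h =>
      mul_nonneg (hη0 k).le (mul_nonneg (hp k a).le h.le)
  have hmono : ∀ᶠ k in atTop, x k a₀ ≤ x (k + 1) a₀ :=
    (hDpos a₀ ha₀).mono fun k h => by rw [hstep']; exact le_add_of_nonneg_right h
  obtain ⟨m, hm⟩ : ∃ m, ∀ᶠ k in atTop, m ≤ x k a₀ := by
    obtain ⟨C, hC⟩ := eventually_le_of_eventually_succ_le (f := fun k => -x k a₀)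
      (hmono.mono fun k h => neg_le_neg h)
    exact ⟨-C, hC.mono fun k h => by linarith⟩
  -- actions with vanishing limiting advantage are eventually comparable with `a₀`
  have hcomp : ∀ a, L a = 0 →
      (∀ᶠ k in atTop, x k a₀ ≤ x k a) ∨ ∀ᶠ k in atTop, x k a ≤ x k a₀ := by
    intro a ha
    have h1 : ∀ᶠ k in atTop, adv k a < ε := (hL a).eventually_lt_const (by rw [ha]; exact hε)
    obtain ⟨K, hK⟩ := eventually_atTop.1 (h1.and hadv₀)
    -- After time `K`, the relation `x k a ≤ x k a₀` persists once it holds: `a₀` then has both the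
    -- larger mass and the larger advantage, so its increment is larger.
    by_cases hex : ∃ k ≥ K, x k a ≤ x k a₀
    · obtain ⟨k₀, hk₀, hle⟩ := hex
      refine Or.inr (eventually_atTop.2 ⟨k₀, fun k hk => ?_⟩)
      induction k, hk using Nat.le_induction with
      | base => exact hle
      | succ n hn ih =>
        obtain ⟨h2, h3⟩ := hK n (hk₀.trans hn)
        rw [hstep', hstep']
        refine add_le_add ih (mul_le_mul_of_nonneg_left ?_ (hη0 n).le)
        calc softmax (x n) a * adv n a ≤ softmax (x n) a * ε :=
              mul_le_mul_of_nonneg_left h2.le (hp n a).le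
          _ ≤ softmax (x n) a₀ * ε :=
              mul_le_mul_of_nonneg_right (softmax_le_softmax ih) hε.le
          _ ≤ softmax (x n) a₀ * adv n a₀ := mul_le_mul_of_nonneg_left h3 (hp n a₀).le
    · push Not at hex
      exact Or.inl (eventually_atTop.2 ⟨K, fun k hk => (hex k hk).le⟩)
  set B : Finset A := Finset.univ.filter fun a =>
    L a = 0 ∧ ∀ᶠ k in atTop, x k a₀ ≤ x k a with hB
  -- the logits of actions with negative limiting advantage stay below that of `a₀`
  have hneg : ∀ a, L a < 0 → ∃ C, ∀ᶠ k in atTop, x k a ≤ C := by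
    intro a ha
    refine eventually_le_of_eventually_succ_le ?_
    filter_upwards [(hL a).eventually_lt_const ha] with k hk
    have := mul_nonpos_of_nonneg_of_nonpos (hη0 k).le
      (mul_nonpos_of_nonneg_of_nonpos (hp k a).le hk.le)
    rw [hstep']
    linarith
  have hratio : ∀ a ∉ B, L a ≤ 0 →
      ∃ C, 0 ≤ C ∧ ∀ᶠ k in atTop, softmax (x k) a ≤ C * softmax (x k) a₀ := by
    intro a haB ha
    rcases ha.lt_or_eq with ha | ha
    · obtain ⟨C, hC⟩ := hneg a ha
      refine ⟨Real.exp (C - m), (Real.exp_pos _).le, ?_⟩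
      filter_upwards [hC, hm] with k h1 h2
      exact softmax_le_mul_of_sub_le (by linarith)
    · have h1 : ¬ ∀ᶠ k in atTop, x k a₀ ≤ x k a := fun h =>
        haB (Finset.mem_filter.2 ⟨Finset.mem_univ a, ha, h⟩)
      refine ⟨1, zero_le_one, ((hcomp a ha).resolve_left h1).mono fun k h => ?_⟩
      simpa using softmax_le_softmax h
  have hstepbound : ∀ a δ, (∀ᶠ k in atTop,
      softmax (x k) a * |adv k a| ≤ δ * (softmax (x k) a₀ * ε)) → 0 ≤ δ →
      ∀ᶠ k in atTop, -D k a ≤ δ * D k a₀ := by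
    intro a δ h hδ
    filter_upwards [h, hadv₀] with k h1 h2
    have h3 : -(softmax (x k) a * adv k a) ≤ softmax (x k) a * |adv k a| := by
      have := mul_le_mul_of_nonneg_left (neg_le_abs (adv k a)) (hp k a).le
      linarith
    have h4 : δ * (softmax (x k) a₀ * ε) ≤ δ * (softmax (x k) a₀ * adv k a₀) :=
      mul_le_mul_of_nonneg_left (mul_le_mul_of_nonneg_left h2 (hp k a₀).le) hδ
    have h5 := mul_le_mul_of_nonneg_left ((h3.trans h1).trans h4) (hη0 k).le
    simp only [hD]
    linarith
  have habs : ∀ a, ∀ᶠ k in atTop, |adv k a| ≤ |L a| + 1 := fun a =>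
    ((hL a).abs.eventually_lt_const (lt_add_one _)).mono fun _ h => h.le
  -- Outside `B`, an action either gains or has mass dominated by that of `a₀` and bounded
  -- advantage, so its loss is at most a multiple of the gain of `a₀`.
  have hbound : ∀ a ∉ B, ∃ C, 0 ≤ C ∧ ∀ᶠ k in atTop, -D k a ≤ C * D k a₀ := by
    intro a haB
    rcases lt_or_ge 0 (L a) with ha | ha
    · exact ⟨0, le_rfl, (hDpos a ha).mono fun k h => by linarith⟩
    · obtain ⟨C, hC0, hC⟩ := hratio a haB ha
      have hC' : 0 ≤ C * (|L a| + 1) / ε := by positivity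
      refine ⟨C * (|L a| + 1) / ε, hC', hstepbound a _ ?_ hC'⟩
      filter_upwards [hC, habs a] with k h1 h2
      calc softmax (x k) a * |adv k a| ≤ C * softmax (x k) a₀ * (|L a| + 1) :=
            mul_le_mul h1 h2 (abs_nonneg _) ((hp k a).le.trans h1)
        _ = C * (|L a| + 1) / ε * (softmax (x k) a₀ * ε) := by field_simp
  -- If the logit of `a₀` diverges, the multiple can be arbitrarily small: for `L a = 0` the
  -- advantage vanishes, for `L a < 0` the mass ratio to `a₀` does.
  have hsmall : Tendsto (fun k => x k a₀) atTop atTop → ∀ δ > 0, ∀ a ∉ B,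
      ∀ᶠ k in atTop, -D k a ≤ δ * D k a₀ := by
    intro htop δ hδ a haB
    rcases lt_trichotomy 0 (L a) with ha | ha | ha
    · filter_upwards [hDpos a ha, hDpos a₀ ha₀] with k h1 h2
      have := mul_nonneg hδ.le h2
      linarith
    · obtain ⟨C, hC0, hC⟩ := hratio a haB ha.ge
      refine hstepbound a δ ?_ hδ.le
      have h1 : ∀ᶠ k in atTop, |adv k a| < δ * ε / (C + 1) := by
        refine (hL a).abs.eventually_lt_const ?_
        rw [← ha, abs_zero]
        positivity
      filter_upwards [hC, h1] with k h2 h3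
      calc softmax (x k) a * |adv k a| ≤ (C + 1) * softmax (x k) a₀ * (δ * ε / (C + 1)) :=
            mul_le_mul (h2.trans (mul_le_mul_of_nonneg_right (by linarith) (hp k a₀).le)) h3.le
              (abs_nonneg _) (mul_nonneg (by linarith) (hp k a₀).le)
        _ = δ * (softmax (x k) a₀ * ε) := by field_simp
    · obtain ⟨C, hC⟩ := hneg a ha
      refine hstepbound a δ ?_ hδ.le
      have hr : 0 < δ * ε / (|L a| + 1) := by positivity
      filter_upwards [hC, habs a,
        htop.eventually_ge_atTop (C - Real.log (δ * ε / (|L a| + 1)))] with k h1 h2 h3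
      have h4 : softmax (x k) a ≤ δ * ε / (|L a| + 1) * softmax (x k) a₀ := by
        have := softmax_le_mul_of_sub_le (x := x k) (a := a) (b := a₀)
          (C := Real.log (δ * ε / (|L a| + 1))) (by linarith)
        rwa [Real.exp_log hr] at this
      calc softmax (x k) a * |adv k a|
          ≤ δ * ε / (|L a| + 1) * softmax (x k) a₀ * (|L a| + 1) :=
            mul_le_mul h4 h2 (abs_nonneg _) ((hp k a).le.trans h4)
        _ = δ * (softmax (x k) a₀ * ε) := by field_simp
  have ha₀B : a₀ ∉ B := by simp [hB, ha₀.ne']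
  have hsumB : ∀ k, ∑ a ∈ B, D k a = ∑ a ∈ Bᶜ, -D k a := fun k => by
    rw [Finset.sum_neg_distrib, eq_neg_iff_add_eq_zero, Finset.sum_add_sum_compl, hDsum]
  -- the total logit of the actions in `B` stays bounded above
  obtain ⟨C, hCD, C₂, hC₂⟩ : ∃ C, (∀ᶠ k in atTop, ∑ a ∈ B, D k a ≤ C * D k a₀) ∧
      ∃ C₂, ∀ᶠ k in atTop, C * x k a₀ ≤ C₂ := by
    -- If `x k a₀` diverges, take `δ = 1 / card A`: the gain of `a₀` pays for all other losses
    -- outside `B`, so the total over `B` does not increase and `C = 0` works. If it is bounded, any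
    -- fixed `C` will do.
    rcases tendsto_atTop_or_bounded_of_eventually_le_succ hmono with htop | ⟨C', hC'⟩
    · refine ⟨0, ?_, 0, by simp⟩
      have hcard : (0 : ℝ) < Fintype.card A := by exact_mod_cast Fintype.card_pos
      have h1 : ∀ a ∈ Bᶜ, ∀ᶠ k in atTop, -D k a ≤ 1 / (Fintype.card A) * D k a₀ :=
        fun a ha => hsmall htop _ (by positivity) a (Finset.mem_compl.1 ha)
      filter_upwards [(Finset.eventually_all _).2 h1, hDpos a₀ ha₀] with k h2 h3
      rw [hsumB, ← Finset.add_sum_erase _ _ (Finset.mem_compl.2 ha₀B)]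
      have h4 : ∑ a ∈ Bᶜ.erase a₀, -D k a ≤
          (Bᶜ.erase a₀).card • (1 / (Fintype.card A) * D k a₀) :=
        Finset.sum_le_card_nsmul _ _ _ fun a ha => h2 a (Finset.mem_of_mem_erase ha)
      rw [nsmul_eq_mul] at h4
      have h5 : ((Bᶜ.erase a₀).card : ℝ) * (1 / (Fintype.card A) * D k a₀) ≤
          Fintype.card A * (1 / (Fintype.card A) * D k a₀) :=
        mul_le_mul_of_nonneg_right (by exact_mod_cast Finset.card_le_univ _) (by positivity)
      rw [← mul_assoc (Fintype.card A : ℝ), mul_one_div_cancel hcard.ne', one_mul] at h5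
      linarith
    · choose! c hc0 hcD using hbound
      refine ⟨∑ a ∈ Bᶜ, c a, ?_, (∑ a ∈ Bᶜ, c a) * C', ?_⟩
      · filter_upwards [(Finset.eventually_all Bᶜ).2
          fun a ha => hcD a (Finset.mem_compl.1 ha)] with k h1
        rw [hsumB, Finset.sum_mul]
        exact Finset.sum_le_sum h1
      · exact hC'.mono fun k h => mul_le_mul_of_nonneg_left h
          (Finset.sum_nonneg fun a ha => hc0 a (Finset.mem_compl.1 ha))
  obtain ⟨C₃, hC₃⟩ := eventually_le_of_eventually_succ_le
    (f := fun k => ∑ a ∈ B, x k a - C * x k a₀) <| hCD.mono fun k h => by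
      simp only [hstep', Finset.sum_add_distrib]
      simp only [hD] at h
      linarith
  have hB0 : ∀ a ∈ B, Tendsto (fun k => softmax (x k) a) atTop (𝓝 0) := by
    intro a ha
    have h1 : ∀ᶠ k in atTop, ∀ b ∈ B, x k a₀ ≤ x k b :=
      (Finset.eventually_all _).2 fun b hb => (Finset.mem_filter.1 hb).2.2
    -- The total logit over `B` is at most `C₃ + C₂` and each other member contributes at least `m`,
    -- which caps `x k a`; the last `m` bounds `x k a₀` from below.
    refine hdom a (Real.exp (C₃ + C₂ - (B.erase a).card * m - m)) ?_
    filter_upwards [h1, hm, hC₂, hC₃] with k h1 h2 h3 h4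
    refine softmax_le_mul_of_sub_le ?_
    rw [← Finset.add_sum_erase _ _ ha] at h4
    have h5 : (B.erase a).card • m ≤ ∑ b ∈ B.erase a, x k b :=
      Finset.card_nsmul_le_sum _ _ _ fun b hb => h2.trans (h1 b (Finset.mem_of_mem_erase hb))
    rw [nsmul_eq_mul] at h5
    linarith
  have hall : ∀ a, Tendsto (fun k => softmax (x k) a) atTop (𝓝 0) := by
    intro a
    by_cases haB : a ∈ B
    · exact hB0 a haB
    · rcases lt_or_ge 0 (L a) with ha | ha
      · exact hp0 a ha.ne'
      · obtain ⟨C, -, hC⟩ := hratio a haB ha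
        exact hdom a C hC
  have hsum := tendsto_finsetSum Finset.univ fun a _ => hall a
  simp only [sum_softmax, Finset.sum_const_zero] at hsum
  exact one_ne_zero (tendsto_nhds_unique tendsto_const_nhds hsum)

end Softmax

/-! ### Bellman operators and the comparison principle -/

section Bellman

theorem norm_reward_le {S A : Type*} [Fintype S] (M : MDP S A) (t : ℕ) (x : S × A) :
    ‖M.γ ^ t * M.r x.1 x.2‖ ≤ M.γ ^ t := by
  have h := M.r_mem x.1 x.2
  have hγ : 0 ≤ M.γ ^ t := pow_nonneg M.γ_mem.1 t
  rw [Real.norm_of_nonneg (mul_nonneg hγ h.1)]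
  exact mul_le_of_le_one_right hγ h.2

variable {S A : Type*} [Fintype S] [Fintype A]

/-- The one-step look-ahead action value of a state function `u`. -/
def qValue (M : MDP S A) (u : S → ℝ) (s : S) (a : A) : ℝ :=
  M.r s a + M.γ * ∑ s', M.P s a s' * u s'

/-- The expectation of a state function after one step under the policy `π`. -/
def policyStep (M : MDP S A) (π : Policy S A) (u : S → ℝ) (s : S) : ℝ :=
  ∑ a, π s a * ∑ s', M.P s a s' * u s'

theorem simplex_sum_mono {X : Type*} [Fintype X] (p : stdSimplex ℝ X) {f g : X → ℝ}
    (h : ∀ x, f x ≤ g x) : ∑ x, p x * f x ≤ ∑ x, p x * g x :=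
  Finset.sum_le_sum fun x _ => mul_le_mul_of_nonneg_left (h x) (stdSimplex.zero_le p x)

theorem simplex_sum_const {X : Type*} [Fintype X] (p : stdSimplex ℝ X) (c : ℝ) :
    ∑ x, p x * c = c := by
  rw [← Finset.sum_mul, stdSimplex.sum_eq_one, one_mul]

theorem le_policyStep (M : MDP S A) (π : Policy S A) {u : S → ℝ} {c : ℝ} (h : ∀ s, c ≤ u s)
    (s : S) : c ≤ policyStep M π u s := by
  have := simplex_sum_mono (π s) fun a =>
    (simplex_sum_const (M.P s a) c).symm.le.trans (simplex_sum_mono (M.P s a) h)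
  rwa [simplex_sum_const] at this

/-- Comparison principle for the discounted Bellman operator of a policy. -/
theorem nonneg_of_policyStep_le (M : MDP S A) (π : Policy S A) {u : S → ℝ}
    (h : ∀ s, M.γ * policyStep M π u s ≤ u s) (s : S) : 0 ≤ u s := by
  -- Minimum principle: at a minimizer `t`, averaging gives `γ * u t ≤ u t`, and `γ < 1` forces `u t
  -- ≥ 0`.
  obtain ⟨t, -, ht⟩ := Finset.exists_min_image Finset.univ u ⟨s, Finset.mem_univ s⟩
  have ht : ∀ s, u t ≤ u s := fun s => ht s (Finset.mem_univ s)
  have h1 := mul_le_mul_of_nonneg_left (le_policyStep M π ht t) M.γ_mem.1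
  have h2 : 0 ≤ (1 - M.γ) * u t := by linarith [h t]
  exact (nonneg_of_mul_nonneg_right h2 (sub_pos.2 M.γ_mem.2)).trans (ht s)

theorem policyStep_sub (M : MDP S A) (π : Policy S A) (u v : S → ℝ) (s : S) :
    policyStep M π (fun s => u s - v s) s = policyStep M π u s - policyStep M π v s := by
  simp only [policyStep, mul_sub, Finset.sum_sub_distrib]

theorem sum_mul_qValue (M : MDP S A) (π : Policy S A) (u : S → ℝ) (s : S) :
    ∑ a, π s a * qValue M u s a = ∑ a, π s a * M.r s a + M.γ * policyStep M π u s := by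
  simp only [qValue, policyStep, mul_add, Finset.sum_add_distrib, Finset.mul_sum]
  congr 1
  exact Finset.sum_congr rfl fun a _ => Finset.sum_congr rfl fun s' _ => by ring

theorem policyStep_const (M : MDP S A) (π : Policy S A) (c : ℝ) (s : S) :
    policyStep M π (fun _ => c) s = c := by
  simp only [policyStep, simplex_sum_const]

/-- The expectation of a function of the next state-action pair. -/
def pairStep (M : MDP S A) (π : Policy S A) (f : S × A → ℝ) (x : S × A) : ℝ :=
  ∑ s, M.P x.1 x.2 s * ∑ a, π s a * f (s, a)

/-- The expected reward at time `t`. -/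
def expectedReward (M : MDP S A) (π : Policy S A) (t : ℕ) (s : S) : ℝ :=
  ∑ a, π s a * (pairStep M π)^[t] (fun x => M.r x.1 x.2) (s, a)

/-- The outermost application of `pairStep` is the first transition of the chain; peeling it off
gives the recursion behind the Bellman equation. -/
theorem expectedReward_succ (M : MDP S A) (π : Policy S A) (t : ℕ) (s : S) :
    expectedReward M π (t + 1) s = policyStep M π (expectedReward M π t) s := by
  simp only [expectedReward, Function.iterate_succ_apply', policyStep]
  rfl

/-! ### Trajectory integrals, the Bellman equation and policy improvement -/

variable [MeasurableSpace S] [MeasurableSpace A]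

theorem integral_pairMeasure [MeasurableSingletonClass S] [MeasurableSingletonClass A]
    (p : stdSimplex ℝ S) (π : Policy S A) (f : S × A → ℝ) :
    ∫ x, f x ∂(pairMeasure p π) = ∑ s, p s * ∑ a, π s a * f (s, a) := by
  have hint : ∀ μ : Measure (S × A), IsFiniteMeasure μ → Integrable f μ :=
    fun μ _ => Integrable.of_finite
  rw [pairMeasure, integral_finsetSum_measure fun s _ => by
    exact (hint _ inferInstance).smul_measure ENNReal.ofReal_ne_top]
  refine Finset.sum_congr rfl fun s _ => ?_
  rw [integral_smul_measure, ENNReal.toReal_ofReal (stdSimplex.zero_le p s), smul_eq_mul,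
    integral_prod _ (hint _ inferInstance), integral_dirac, simplexMeasure,
    integral_finsetSum_measure fun a _ => by
      exact (Integrable.of_finite).smul_measure ENNReal.ofReal_ne_top]
  congr 1
  refine Finset.sum_congr rfl fun a _ => ?_
  rw [integral_smul_measure, ENNReal.toReal_ofReal (stdSimplex.zero_le (π s) a), smul_eq_mul,
    integral_dirac]

variable [MeasurableSingletonClass S] [MeasurableSingletonClass A]

theorem integral_stepKernel (M : MDP S A) (π : Policy S A) (f : S × A → ℝ) (x : S × A) :
    ∫ y, f y ∂(stepKernel M π x) = pairStep M π f x :=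
  integral_pairMeasure (M.P x.1 x.2) π f

instance (M : MDP S A) (π : Policy S A) (s : S) : IsProbabilityMeasure (trajectoryLaw M π s) :=
  inferInstanceAs (IsProbabilityMeasure (Kernel.trajMeasure (X := fun _ => S × A) _ _))

theorem integrable_trajectoryLaw (M : MDP S A) (π : Policy S A) (s : S) (f : S × A → ℝ) (t : ℕ) :
    Integrable (fun ω => f (ω t)) (trajectoryLaw M π s) := by
  have h : Integrable f ((trajectoryLaw M π s).map fun ω => ω t) := Integrable.of_finite
  exact h.comp_measurable (measurable_pi_apply t)

/-- This is the Markov property: the joint law of the history up to `t` and the next pair is a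
composition product, and the history kernel sees only the last pair. -/
theorem integral_trajectoryLaw_succ (M : MDP S A) (π : Policy S A) (s : S) (f : S × A → ℝ)
    (t : ℕ) :
    ∫ ω, f (ω (t + 1)) ∂(trajectoryLaw M π s) =
      ∫ ω, pairStep M π f (ω t) ∂(trajectoryLaw M π s) := by
  have hf : Measurable f := measurable_of_finite f
  have key := Kernel.map_frestrictLe_trajMeasure_compProd_eq_map_trajMeasure
    (X := fun _ => S × A) (μ₀ := (Measure.dirac s).prod (simplexMeasure (π s)))
    (κ := historyKernel M π) (a := t)
  have hm : Measurable fun x : ℕ → S × A =>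
      (Preorder.frestrictLe (π := fun _ => S × A) t x, x (t + 1)) := by
    fun_prop
  have hprob := (inferInstance : IsProbabilityMeasure (trajectoryLaw M π s))
  unfold trajectoryLaw at hprob ⊢
  have h1 := integral_map (μ := Kernel.trajMeasure (X := fun _ => S × A)
    ((Measure.dirac s).prod (simplexMeasure (π s))) (historyKernel M π)) hm.aemeasurable
    (f := fun y => f y.2) (hf.comp measurable_snd).aestronglyMeasurable
  have hstep : ∀ h : Finset.Iic t → S × A, ∫ y, f y ∂(historyKernel M π t h) =
      pairStep M π f (h ⟨t, Finset.mem_Iic.2 le_rfl⟩) := fun h => integral_stepKernel M π f _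
  rw [← h1, ← key, Measure.integral_compProd]
  · simp only [hstep]
    rw [integral_map (by fun_prop)]
    · rfl
    · exact ((measurable_of_finite (pairStep M π f)).comp
        (measurable_pi_apply (⟨t, Finset.mem_Iic.2 le_rfl⟩ : Finset.Iic t))).aestronglyMeasurable
  · rw [key]
    refine (integrable_map_measure ?_ hm.aemeasurable).2 ?_
    · exact (hf.comp measurable_snd).aestronglyMeasurable
    · exact integrable_trajectoryLaw M π s f (t + 1)

theorem trajectoryLaw_map_zero (M : MDP S A) (π : Policy S A) (s : S) :
    (trajectoryLaw M π s).map (fun ω => ω 0) =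
      (Measure.dirac s).prod (simplexMeasure (π s)) := by
  have h : (fun ω : ℕ → S × A => ω 0) =
      (fun h : Finset.Iic 0 → S × A => h ⟨0, Finset.mem_Iic.2 le_rfl⟩) ∘
        Preorder.frestrictLe (π := fun _ => S × A) 0 := rfl
  rw [h, ← Measure.map_map (measurable_pi_apply _) (by fun_prop), trajectoryLaw,
    Kernel.trajMeasure, Measure.map_comp _ _ (by fun_prop), Kernel.traj_map_frestrictLe,
    Kernel.partialTraj_self, Measure.id_comp, Measure.map_map (measurable_pi_apply _) (by fun_prop)]
  exact Measure.map_id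

theorem integral_trajectoryLaw_zero (M : MDP S A) (π : Policy S A) (s : S) (f : S × A → ℝ) :
    ∫ ω, f (ω 0) ∂(trajectoryLaw M π s) = ∑ a, π s a * f (s, a) := by
  have hf : Measurable f := measurable_of_finite f
  rw [← integral_map (f := f) (φ := fun ω : ℕ → S × A => ω 0)
    (measurable_pi_apply 0).aemeasurable hf.aestronglyMeasurable, trajectoryLaw_map_zero,
    integral_prod _ Integrable.of_finite, integral_dirac, simplexMeasure,
    integral_finsetSum_measure fun a _ => by
      exact (Integrable.of_finite).smul_measure ENNReal.ofReal_ne_top]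
  refine Finset.sum_congr rfl fun a _ => ?_
  rw [integral_smul_measure, ENNReal.toReal_ofReal (stdSimplex.zero_le (π s) a), smul_eq_mul,
    integral_dirac]

theorem integral_trajectoryLaw (M : MDP S A) (π : Policy S A) (s : S) (t : ℕ) (f : S × A → ℝ) :
    ∫ ω, f (ω t) ∂(trajectoryLaw M π s) = ∑ a, π s a * (pairStep M π)^[t] f (s, a) := by
  induction t generalizing f with
  | zero => exact integral_trajectoryLaw_zero M π s f
  | succ t ih => rw [integral_trajectoryLaw_succ, ih, Function.iterate_succ_apply]

theorem hasSum_value (M : MDP S A) (π : Policy S A) (s : S) :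
    HasSum (fun t => M.γ ^ t * expectedReward M π t s) (value M π s) := by
  have hint : ∀ t, Integrable (fun ω : ℕ → S × A => M.γ ^ t * M.r (ω t).1 (ω t).2)
      (trajectoryLaw M π s) := fun t =>
    integrable_trajectoryLaw M π s (fun x => M.γ ^ t * M.r x.1 x.2) t
  have hsum : Summable fun t => ∫ ω : ℕ → S × A, ‖M.γ ^ t * M.r (ω t).1 (ω t).2‖
      ∂(trajectoryLaw M π s) := by
    refine Summable.of_nonneg_of_le (fun t => integral_nonneg fun _ => norm_nonneg _) (fun t => ?_)
      (summable_geometric_of_lt_one M.γ_mem.1 M.γ_mem.2)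
    have := integral_mono (hint t).norm (integrable_const (M.γ ^ t))
      fun ω => norm_reward_le M t (ω t)
    simpa using this
  have h := hasSum_integral_of_summable_integral_norm hint hsum
  have ht : ∀ t, ∫ ω : ℕ → S × A, M.γ ^ t * M.r (ω t).1 (ω t).2 ∂(trajectoryLaw M π s) =
      M.γ ^ t * expectedReward M π t s := fun t => by
    rw [integral_const_mul]
    exact congrArg _ (integral_trajectoryLaw M π s t fun x => M.r x.1 x.2)
  simp only [ht] at h
  exact h

/-- The Bellman equation. -/
theorem value_eq (M : MDP S A) (π : Policy S A) (s : S) :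
    value M π s = ∑ a, π s a * M.r s a + M.γ * policyStep M π (value M π) s := by
  have h1 : HasSum (fun t => M.γ ^ (t + 1) * expectedReward M π (t + 1) s)
      (M.γ * policyStep M π (value M π) s) := by
    have : HasSum (fun t => M.γ * policyStep M π (fun s => M.γ ^ t * expectedReward M π t s) s)
        (M.γ * policyStep M π (value M π) s) :=
      (hasSum_sum fun a _ => (hasSum_sum fun s' _ =>
        (hasSum_value M π s').mul_left _).mul_left _).mul_left _
    convert this using 2 with t
    rw [expectedReward_succ, pow_succ']
    simp only [policyStep, Finset.mul_sum]
    refine Finset.sum_congr rfl fun a _ => Finset.sum_congr rfl fun s' _ => by ring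
  -- Undoing the shift restores the term `t = 0`, the immediate mean reward.
  have h2 := (hasSum_nat_add_iff (f := fun t => M.γ ^ t * expectedReward M π t s) 1).1 h1
  rw [(hasSum_value M π s).unique h2, add_comm]
  simp [expectedReward]

theorem value_eq_sum_qValue (M : MDP S A) (π : Policy S A) (s : S) :
    value M π s = ∑ a, π s a * qValue M (value M π) s a := by
  rw [sum_mul_qValue, ← value_eq]

theorem value_nonneg (M : MDP S A) (π : Policy S A) (s : S) : 0 ≤ value M π s := by
  refine nonneg_of_policyStep_le M π (fun s => ?_) s
  have : 0 ≤ ∑ a, π s a * M.r s a :=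
    Finset.sum_nonneg fun a _ => mul_nonneg (stdSimplex.zero_le (π s) a) (M.r_mem s a).1
  linarith [value_eq M π s]

theorem value_le (M : MDP S A) (π : Policy S A) (s : S) : value M π s ≤ 1 / (1 - M.γ) := by
  have h1γ : 0 < 1 - M.γ := sub_pos.2 M.γ_mem.2
  refine sub_nonneg.1 (nonneg_of_policyStep_le M π (u := fun s => 1 / (1 - M.γ) - value M π s)
    (fun s => ?_) s)
  have h := simplex_sum_mono (π s) (g := fun _ => 1) fun a => (M.r_mem s a).2
  rw [simplex_sum_const] at h
  have h2 : 1 / (1 - M.γ) - M.γ * (1 / (1 - M.γ)) = 1 := by field_simp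
  rw [policyStep_sub, policyStep_const, value_eq M π s]
  linarith

theorem bddAbove_value (M : MDP S A) (s : S) :
    BddAbove (Set.range fun π : Policy S A => value M π s) :=
  ⟨1 / (1 - M.γ), by rintro _ ⟨π, rfl⟩; exact value_le M π s⟩

/-- The difference of two values satisfies a Bellman equation whose reward is the mean advantage
of the first policy over the second. -/
theorem value_sub_value (M : MDP S A) (π π' : Policy S A) (s : S) :
    value M π' s - value M π s =
      ∑ a, π' s a * (qValue M (value M π) s a - value M π s) +
        M.γ * policyStep M π' (fun s => value M π' s - value M π s) s := by
  rw [policyStep_sub]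
  simp only [mul_sub, Finset.sum_sub_distrib, simplex_sum_const]
  rw [sum_mul_qValue, value_eq M π' s]
  ring

/-- If the mean advantages of `π'` over `π` are nonnegative, they bound the improvement of the value
from below. -/
theorem value_improvement (M : MDP S A) {π π' : Policy S A}
    (h : ∀ s, 0 ≤ ∑ a, π' s a * (qValue M (value M π) s a - value M π s)) (s : S) :
    ∑ a, π' s a * (qValue M (value M π) s a - value M π s) ≤ value M π' s - value M π s := by
  have h1 := nonneg_of_policyStep_le M π' (u := fun s => value M π' s - value M π s) fun s => by
    linarith [value_sub_value M π π' s, h s]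
  have h2 := mul_nonneg M.γ_mem.1 (le_policyStep M π' h1 s)
  linarith [value_sub_value M π π' s]

/-- A state function dominating all its one-step look-aheads dominates the optimal value. -/
theorem value_le_of_qValue_le (M : MDP S A) {u : S → ℝ} (h : ∀ s a, qValue M u s a ≤ u s)
    (π : Policy S A) (s : S) : value M π s ≤ u s := by
  refine sub_nonneg.1 (nonneg_of_policyStep_le M π (u := fun s => u s - value M π s)
    (fun s => ?_) s)
  have h1 := simplex_sum_mono (π s) (h s)
  rw [simplex_sum_const, sum_mul_qValue] at h1
  rw [policyStep_sub]
  linarith [value_eq M π s]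

end Bellman

/-! ### Discounted occupancy weights -/

section Occupancy

variable {S A : Type*} [Fintype S] [Fintype A]

/-- The operator `id - γ P_π` on state functions. -/
def resolventOperator (M : MDP S A) (π : Policy S A) : (S → ℝ) →ₗ[ℝ] (S → ℝ) where
  toFun u s := u s - M.γ * policyStep M π u s
  map_add' u v := by
    ext s
    simp only [policyStep, Pi.add_apply, mul_add, Finset.sum_add_distrib]
    ring
  map_smul' c u := by
    ext s
    simp only [policyStep, Pi.smul_apply, smul_eq_mul, RingHom.id_apply, mul_sub, Finset.mul_sum]
    congr 1
    exact Finset.sum_congr rfl fun a _ => Finset.sum_congr rfl fun s' _ => by ring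

theorem resolventOperator_nonneg {M : MDP S A} {π : Policy S A} {u : S → ℝ}
    (h : ∀ s, 0 ≤ resolventOperator M π u s) (s : S) : 0 ≤ u s :=
  nonneg_of_policyStep_le M π (fun s => sub_nonneg.1 (h s)) s

theorem le_of_resolventOperator_nonneg {M : MDP S A} {π : Policy S A} {u : S → ℝ}
    (h : ∀ s, 0 ≤ resolventOperator M π u s) (s : S) : resolventOperator M π u s ≤ u s :=
  sub_le_self _ (mul_nonneg M.γ_mem.1 (le_policyStep M π (resolventOperator_nonneg h) s))

theorem resolventOperator_injective (M : MDP S A) (π : Policy S A) :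
    Function.Injective (resolventOperator M π) := by
  rw [injective_iff_map_eq_zero]
  intro u hu
  ext s
  refine le_antisymm ?_ (resolventOperator_nonneg (fun s => by rw [hu]; exact le_rfl) s)
  have h := resolventOperator_nonneg (M := M) (π := π) (u := -u)
    (fun s => by rw [map_neg, hu]; simp) s
  simpa using h

/-- Discounted occupancy weights: the linear functional `u ↦ ∑ μ u`, read off from the Bellman
residual of `u`, has weights at least `μ`. -/
theorem exists_occupancy (M : MDP S A) (π : Policy S A) {μ : S → ℝ} (hμ : ∀ s, 0 ≤ μ s) :
    ∃ w : S → ℝ, (∀ s, μ s ≤ w s) ∧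
      ∀ h u : S → ℝ, (∀ s, u s = h s + M.γ * policyStep M π u s) →
        ∑ s, μ s * u s = ∑ s, w s * h s := by
  classical
  let E := LinearEquiv.ofInjectiveEndo _ (resolventOperator_injective M π)
  have hE : ∀ h, resolventOperator M π (E.symm h) = h := E.apply_symm_apply
  -- The weights are the row vector `μ (id - γ P_π)⁻¹`. The inverse is a positive operator that
  -- dominates the identity on nonnegative functions, whence `μ ≤ w`.
  refine ⟨fun t => ∑ s, μ s * E.symm (Pi.single t 1) s, fun t => ?_, fun h u hu => ?_⟩
  · have h1 : ∀ s, 0 ≤ resolventOperator M π (E.symm (Pi.single t 1)) s := fun s => by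
      rw [hE]
      by_cases hst : s = t
      · subst hst; simp
      · simp [hst]
    have h2 := le_of_resolventOperator_nonneg h1 t
    rw [hE, Pi.single_eq_same] at h2
    calc μ t ≤ μ t * E.symm (Pi.single t 1) t := le_mul_of_one_le_right (hμ t) h2
      _ ≤ _ := Finset.single_le_sum (f := fun s => μ s * E.symm (Pi.single t 1) s)
        (fun s _ => mul_nonneg (hμ s) (resolventOperator_nonneg h1 s)) (Finset.mem_univ t)
  · have h1 : u = E.symm h := by
      refine resolventOperator_injective M π ?_
      rw [hE]
      ext s
      exact sub_eq_iff_eq_add.2 (hu s)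
    have h2 : E.symm h = ∑ t, h t • E.symm (Pi.single t 1) := by
      conv_lhs => rw [pi_eq_sum_univ' h]
      simp only [map_sum, map_smul]
    rw [h1, h2]
    simp only [Finset.sum_apply, Pi.smul_apply, smul_eq_mul, Finset.mul_sum, Finset.sum_mul]
    rw [Finset.sum_comm]
    exact Finset.sum_congr rfl fun t _ => Finset.sum_congr rfl fun s _ => by ring

end Occupancy

/-! ### Differentiating the value: the policy gradient theorem -/

/-- The product of a differentiable function vanishing at a point and a function continuous there
is differentiable at that point. -/
theorem hasFDerivAt_mul_of_eq_zero {E : Type*} [NormedAddCommGroup E] [NormedSpace ℝ E]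
    {f g : E → ℝ} {f' : E →L[ℝ] ℝ} {x : E} (hf : HasFDerivAt f f' x) (hfx : f x = 0)
    (hg : ContinuousAt g x) : HasFDerivAt (fun y => f y * g y) (g x • f') x := by
  rw [hasFDerivAt_iff_isLittleO]
  have h1 := (hasFDerivAt_iff_isLittleO.1 hf).const_mul_left (g x)
  have h2 : (fun y => g y - g x) =o[𝓝 x] fun _ => (1 : ℝ) := by
    rw [Asymptotics.isLittleO_one_iff]
    exact tendsto_sub_nhds_zero_iff.2 hg
  have h3 := hf.isBigO_sub.norm_right.mul_isLittleO h2
  simp only [mul_one] at h3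
  refine (h1.add h3.of_norm_right).congr_left fun y => ?_
  simp only [hfx, zero_mul, smul_apply, smul_eq_mul]
  ring

theorem euclideanSpace_proj_apply {ι : Type*} (i : ι) (v : EuclideanSpace ℝ ι) :
    (EuclideanSpace.proj i : EuclideanSpace ℝ ι →L[ℝ] ℝ) v = v i := rfl

section Gradient

variable {S A : Type*} [Fintype S] [Fintype A]
variable [MeasurableSpace S] [MeasurableSingletonClass S]
variable [MeasurableSpace A] [MeasurableSingletonClass A]

/-- Performance difference with the occupancy weights frozen at `π`. The dependence on `π'` sits in
a factor vanishing at `π' = π` and in the action value of `π'`, so continuity of the latter suffices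
to differentiate at `π`. -/
theorem sum_mul_value_sub_value (M : MDP S A) (π : Policy S A) {μ w : S → ℝ}
    (hw : ∀ h u : S → ℝ, (∀ s, u s = h s + M.γ * policyStep M π u s) →
      ∑ s, μ s * u s = ∑ s, w s * h s) (π' : Policy S A) :
    ∑ s, μ s * (value M π' s - value M π s) =
      ∑ s, w s * ∑ a, (π' s a - π s a) * qValue M (value M π') s a := by
  refine hw _ _ fun s => ?_
  have h := value_sub_value M π' π s
  have h2 := value_eq_sum_qValue M π' s
  rw [policyStep_sub] at h ⊢
  simp only [mul_sub, sub_mul, Finset.sum_sub_distrib, simplex_sum_const] at h ⊢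
  linarith

theorem norm_qValue_value_le (M : MDP S A) (π : Policy S A) (s : S) (a : A) :
    ‖qValue M (value M π) s a‖ ≤ 1 + M.γ * (1 / (1 - M.γ)) := by
  have h1 := simplex_sum_mono (M.P s a) (value_le M π)
  have h2 := simplex_sum_mono (M.P s a) (value_nonneg M π)
  rw [simplex_sum_const] at h1 h2
  rw [qValue, Real.norm_of_nonneg (add_nonneg (M.r_mem s a).1 (mul_nonneg M.γ_mem.1 h2))]
  exact add_le_add (M.r_mem s a).2 (mul_le_mul_of_nonneg_left h1 M.γ_mem.1)

/-- The performance difference identity with a point mass at `s` writes the increment as null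
factors times action values that are bounded uniformly in the policy. -/
theorem continuousAt_value {E : Type*} [TopologicalSpace E] (M : MDP S A) {π : E → Policy S A}
    {x : E} (hπ : ∀ s a, ContinuousAt (fun y => π y s a) x) (s : S) :
    ContinuousAt (fun y => value M (π y) s) x := by
  classical
  obtain ⟨w, -, hw⟩ := exists_occupancy M (π x) (μ := Pi.single s 1) fun t => by
    by_cases h : t = s
    · subst h; simp
    · simp [h]
  have h1 : ∀ y, value M (π y) s - value M (π x) s =
      ∑ s, w s * ∑ a, (π y s a - π x s a) * qValue M (value M (π y)) s a := fun y => by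
    rw [← sum_mul_value_sub_value M (π x) hw]
    simp [Pi.single_apply]
  refine tendsto_sub_nhds_zero_iff.1 ?_
  simp only [h1]
  have h2 : ∀ s a, Tendsto (fun y => (π y s a - π x s a) * qValue M (value M (π y)) s a)
      (𝓝 x) (𝓝 0) := fun s a =>
    (tendsto_sub_nhds_zero_iff.2 (hπ s a)).zero_mul_isBoundedUnder_le
      (isBoundedUnder_of_eventually_le
        (Eventually.of_forall fun y => norm_qValue_value_le M (π y) s a))
  simpa using tendsto_finsetSum Finset.univ fun s _ =>
    (tendsto_finsetSum Finset.univ fun a _ => h2 s a).const_mul (w s)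

theorem hasFDerivAt_softmaxPolicy {S A : Type*} [Fintype S] [Fintype A] [Nonempty A]
    (θ : EuclideanSpace ℝ (S × A)) (s : S) (a : A) :
    HasFDerivAt (fun θ : EuclideanSpace ℝ (S × A) => softmaxPolicy θ s a)
      (softmaxPolicy θ s a • ((EuclideanSpace.proj (s, a) : EuclideanSpace ℝ (S × A) →L[ℝ] ℝ) -
        ∑ b, softmaxPolicy θ s b • (EuclideanSpace.proj (s, b)))) θ := by
  have he : ∀ b, HasFDerivAt (fun θ : EuclideanSpace ℝ (S × A) => Real.exp (θ (s, b)))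
      (Real.exp (θ (s, b)) • (EuclideanSpace.proj (s, b) : EuclideanSpace ℝ (S × A) →L[ℝ] ℝ)) θ :=
    fun b => (EuclideanSpace.proj (s, b) : EuclideanSpace ℝ (S × A) →L[ℝ] ℝ).hasFDerivAt.exp
  have hZ : (∑ b, Real.exp (θ (s, b))) ≠ 0 := by positivity
  have hsum := HasFDerivAt.fun_sum (u := Finset.univ) fun b _ => he b
  have h := (he a).mul ((hasDerivAt_inv hZ).comp_hasFDerivAt θ hsum)
  refine h.congr_fderiv ?_
  ext v
  have hp : ∀ b, softmaxPolicy θ s b = Real.exp (θ (s, b)) / ∑ b, Real.exp (θ (s, b)) :=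
    fun _ => rfl
  simp only [hp, add_apply, smul_apply,
    sub_apply, sum_apply, smul_eq_mul,
    euclideanSpace_proj_apply, Function.comp_apply, div_mul_eq_mul_div, ← Finset.sum_div]
  field_simp
  ring

/-- The policy gradient theorem for the softmax parametrization. -/
theorem hasGradientAt_valueAt_softmaxPolicy [Nonempty A] (M : MDP S A) (μ : stdSimplex ℝ S)
    (θ : EuclideanSpace ℝ (S × A)) :
    ∃ w : S → ℝ, (∀ s, μ s ≤ w s) ∧
      HasGradientAt (fun θ => valueAt M (softmaxPolicy θ) μ)
        (WithLp.toLp 2 fun x : S × A => w x.1 * (softmaxPolicy θ x.1 x.2 *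
          (qValue M (value M (softmaxPolicy θ)) x.1 x.2 - value M (softmaxPolicy θ) x.1))) θ := by
  obtain ⟨w, hwμ, hw⟩ := exists_occupancy M (softmaxPolicy θ) (stdSimplex.zero_le μ)
  refine ⟨w, hwμ, ?_⟩
  rw [hasGradientAt_iff_hasFDerivAt]
  have hcont : ∀ s, ContinuousAt (fun θ' => value M (softmaxPolicy θ') s) θ :=
    continuousAt_value M fun s a => (hasFDerivAt_softmaxPolicy θ s a).continuousAt
  have hq : ∀ s a, ContinuousAt (fun θ' => qValue M (value M (softmaxPolicy θ')) s a) θ :=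
    fun s a => continuousAt_const.add (continuousAt_const.mul
      (tendsto_finsetSum Finset.univ fun s' _ => continuousAt_const.mul (hcont s')))
  have hterm := fun s a => hasFDerivAt_mul_of_eq_zero
    ((hasFDerivAt_softmaxPolicy θ s a).sub_const (softmaxPolicy θ s a)) (sub_self _) (hq s a)
  have htotal := (HasFDerivAt.fun_sum (u := Finset.univ) fun s _ =>
    (HasFDerivAt.fun_sum (u := Finset.univ) fun a _ => hterm s a).const_mul (w s)).const_add
      (valueAt M (softmaxPolicy θ) μ)
  refine (htotal.congr_of_eventuallyEq (Eventually.of_forall fun θ' => ?_)).congr_fderiv ?_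
  · have h := sum_mul_value_sub_value M (softmaxPolicy θ) hw (softmaxPolicy θ')
    simp only [mul_sub, Finset.sum_sub_distrib] at h
    simp only [valueAt]
    simp only [← h]
    ring
  · ext v
    simp only [smul_apply, sub_apply,
      sum_apply, smul_eq_mul, euclideanSpace_proj_apply,
      InnerProductSpace.toDual_apply_apply, PiLp.inner_apply, Fintype.sum_prod_type,
      RCLike.inner_apply, conj_trivial]
    refine Finset.sum_congr rfl fun s _ => ?_
    -- The normalization term in the softmax derivative subtracts the policy mean of the action
    -- values, which is the state value; this turns action values into advantages.
    have hV := value_eq_sum_qValue M (softmaxPolicy θ) s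
    set V := value M (softmaxPolicy θ) with hVdef
    set p := softmaxPolicy θ s with hp
    have h1 : ∑ a, qValue M V s a * (p a * (v (s, a) - ∑ b, p b * v (s, b))) =
        ∑ a, qValue M V s a * (p a * v (s, a)) - V s * ∑ b, p b * v (s, b) := by
      rw [hV, Finset.sum_mul, ← Finset.sum_sub_distrib]
      exact Finset.sum_congr rfl fun a _ => by ring
    rw [h1, Finset.mul_sum, ← Finset.sum_sub_distrib, Finset.mul_sum]
    exact Finset.sum_congr rfl fun a _ => by ring

end Gradient

/-! ### Convergence to the optimal value -/

section Convergence

variable {S A : Type*} [Fintype S] [Fintype A] [Nonempty A]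
variable [MeasurableSpace S] [MeasurableSingletonClass S]
variable [MeasurableSpace A] [MeasurableSingletonClass A]

/-- A policy gradient step is, in each state, a softmax ascent step along the advantages, with an
effective step size at least `α μ(s)`. -/
theorem exists_softmaxPG_succ_eq (M : MDP S A) (μ : stdSimplex ℝ S) {η : ℕ → ℝ} {α : ℝ}
    (hα : 0 < α) (hη : ∀ k, α ≤ η k) (θ₀ : EuclideanSpace ℝ (S × A)) (k : ℕ) :
    ∃ c : S → ℝ, (∀ s, α * μ s ≤ c s) ∧ ∀ s a,
      softmaxPG M μ η θ₀ (k + 1) (s, a) = softmaxPG M μ η θ₀ k (s, a) +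
        c s * (softmaxPolicy (softmaxPG M μ η θ₀ k) s a *
          (qValue M (value M (softmaxPolicy (softmaxPG M μ η θ₀ k))) s a -
            value M (softmaxPolicy (softmaxPG M μ η θ₀ k)) s)) := by
  obtain ⟨w, hw, hgrad⟩ := hasGradientAt_valueAt_softmaxPolicy M μ (softmaxPG M μ η θ₀ k)
  refine ⟨fun s => η k * w s, fun s => ?_, fun s a => ?_⟩
  · exact mul_le_mul (hη k) (hw s) (stdSimplex.zero_le μ s) (hα.le.trans (hη k))
  · rw [softmaxPG, hgrad.gradient]
    simp only [PiLp.add_apply, PiLp.smul_apply, smul_eq_mul, mul_assoc]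

theorem tendsto_value_softmaxPG (M : MDP S A) (μ : stdSimplex ℝ S) (hμ : ∀ s, 0 < μ s)
    (η : ℕ → ℝ) (α : ℝ) (hα : 0 < α) (hη : ∀ k, α ≤ η k)
    (θ₀ : EuclideanSpace ℝ (S × A)) (s : S) :
    Tendsto (fun k => value M (softmaxPolicy (softmaxPG M μ η θ₀ k)) s) atTop
      (𝓝 (optValue M s)) := by
  choose c hc hstep using exists_softmaxPG_succ_eq M μ hα hη θ₀
  set π : ℕ → Policy S A := fun k => softmaxPolicy (softmaxPG M μ η θ₀ k) with hπ
  set x : S → ℕ → A → ℝ := fun s k a => softmaxPG M μ η θ₀ k (s, a) with hx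
  set adv : S → ℕ → A → ℝ := fun s k a => qValue M (value M (π k)) s a - value M (π k) s with hadv
  have hsoft : ∀ k s a, π k s a = softmax (x s k) a := fun _ _ _ => rfl
  have hcpos : ∀ s, 0 < α * μ s := fun s => mul_pos hα (hμ s)
  have hstep' : ∀ s k, x s (k + 1) = fun a => x s k a + c k s * (softmax (x s k) a * adv s k a) :=
    fun s k => funext fun a => hstep k s a
  have h0 : ∀ s k, ∑ a, softmax (x s k) a * adv s k a = 0 := fun s k => by
    simp only [← hsoft, hadv, mul_sub, Finset.sum_sub_distrib, simplex_sum_const]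
    exact sub_eq_zero.2 (value_eq_sum_qValue M (π k) s).symm
  have hnn : ∀ s k, 0 ≤ ∑ a, softmax (x s (k + 1)) a * adv s k a := fun s k => by
    rw [hstep']
    exact sum_softmax_step_mul_nonneg _ _ ((hcpos s).le.trans (hc k s)) (h0 s k)
  have hle : ∀ s k, ∑ a, softmax (x s (k + 1)) a * adv s k a ≤
      value M (π (k + 1)) s - value M (π k) s := fun s k =>
    value_improvement M (π := π k) (π' := π (k + 1)) (fun s => hnn s k) s
  have hmono : ∀ s, Monotone fun k => value M (π k) s := fun s =>
    monotone_nat_of_le_succ fun k => sub_nonneg.1 ((hnn s k).trans (hle s k))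
  have hlim : ∀ s, ∃ l, Tendsto (fun k => value M (π k) s) atTop (𝓝 l) := fun s =>
    ⟨_, tendsto_atTop_ciSup (hmono s)
      ⟨1 / (1 - M.γ), by rintro _ ⟨k, rfl⟩; exact value_le M (π k) s⟩⟩
  choose V hV using hlim
  have hadvlim : ∀ s a, Tendsto (fun k => adv s k a) atTop (𝓝 (qValue M V s a - V s)) :=
    fun s a => (tendsto_const_nhds.add (tendsto_const_nhds.mul
      (tendsto_finsetSum _ fun s' _ => tendsto_const_nhds.mul (hV s')))).sub (hV s)
  -- The mean advantages lie between zero and the increments of a convergent sequence.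
  have himp : ∀ s, Tendsto (fun k => ∑ a, softmax (x s (k + 1)) a * adv s k a) atTop (𝓝 0) :=
    fun s => squeeze_zero (hnn s) (hle s) (by
      simpa using ((tendsto_add_atTop_iff_nat 1).2 (hV s)).sub (hV s))
  have hopt : ∀ s a, qValue M V s a ≤ V s := fun s a => sub_nonpos.1
    (softmax_ascent_limit_adv_nonpos (hcpos s) (fun k => hc k s) (hadvlim s) (h0 s) (hstep' s)
      (himp s) a)
  -- `V` dominates every policy value by `hopt`, and as a limit of policy values it cannot exceed
  -- their supremum.
  have heq : optValue M s = V s := by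
    have : Nonempty (Policy S A) := ⟨π 0⟩
    exact le_antisymm (ciSup_le fun π' => value_le_of_qValue_le M hopt π' s)
      (le_of_tendsto' (hV s) fun k => le_ciSup (bddAbove_value M s) (π k))
  rw [heq]
  exact hV s

end Convergence

end FiniteMDP

theorem theorem4p4 {S A : Type*} [Fintype S] [Fintype A] [Nonempty A]
    [MeasurableSpace S] [MeasurableSingletonClass S]
    [MeasurableSpace A] [MeasurableSingletonClass A]
    (M : FiniteMDP.MDP S A) (μ : stdSimplex ℝ S) (hμ : ∀ s, 0 < μ s)
    (η : ℕ → ℝ) (α : ℝ) (hα : 0 < α) (hη : ∀ k, α ≤ η k)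
    (θ₀ : EuclideanSpace ℝ (S × A)) (s : S) :
    Tendsto
      (fun k => FiniteMDP.value M
        (FiniteMDP.softmaxPolicy (FiniteMDP.softmaxPG M μ η θ₀ k)) s)
      atTop (𝓝 (FiniteMDP.optValue M s)) :=
  FiniteMDP.tendsto_value_softmaxPG M μ hμ η α hα hη θ₀ s
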